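/- **Terminology.** A tree is a strict partial order in which the set of predecessors of each node is well-ordered; the height of a node is the order type of that set, and $\mathrm{sons}(x)$ is the set of immediate successors of $x$. A branch is an inclusion-maximal chain. A foliage tree $\mathbf F$ is a tree together with a set (leaf) $\mathbf F_x$ for each node $x$. For families of sets, $\gamma\gg\delta$ ("$\gamma$ $\pi$-refines $\delta$") means that each nonempty $D\in\delta$ contains some nonempty $G\in\gamma$. For a set $B$, $\mathrm{cofin}\,B=\{B\setminus K: K\subseteq B\text{ finite}\}$. Put $\mathrm{shoot}_{\mathbf F}(x)=\{\bigcup_{y\in C}\mathbf F_y : C\in\mathrm{cofin}(\mathrm{sons}(x))\}$ and $$\mathrm{rise}_{\mathbf F}(p,U)=\{\mathrm{height}_{\mathbf F}(x) : p\in\mathbf F_x,\ \mathrm{shoot}_{\mathbf F}(x)\gg\{U\}\},$$ and, for a topological space $X$, let $\mathrm{Rise}_{\mathbf F}(X)$ be the family of all sets $\mathrm{rise}_{\mathbf F}(p,U)$, where $p\in X$ and $U$ is a (not necessarily open) neighbourhood of $p$ in $X$. A *Baire foliage tree on $X$* is a foliage tree $\mathbf F$ such that: its tree is isomorphic to the tree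 ${}^{<\omega}\omega$ of finite sequences of natural numbers ordered by proper extension; every leaf is open in $X$; the leaf at the least node is $X$; the leaf at each non-maximal node is the disjoint union of the leaves at its sons; and for every branch $B$ the set $\bigcap_{x\in B}\mathbf F_x$ is a singleton. A *$\pi$-tree on $X$* is a Baire foliage tree $\mathbf F$ on $X$ such that for every $p\in X$ and every neighbourhood $U$ of $p$ there is a node $x$ with $p\in\mathbf F_x$ and $\mathrm{shoot}_{\mathbf F}(x)\gg\{U\}$. **Theorem.** Let $X$ be a topological space and let $A\subseteq X$ be at most countable. (1) If $\mathbf F$ is a Baire foliage tree on $X$, then there exists a Baire foliage tree $\mathbf H$ on the subspace $X\setminus A$ such that for every $p\in X\setminus A$ there is a strictly increasing function $f_p\colon\omega\to\omega$ with $$\{2n+1 : n\in\omega,\ f_p(n)\in\mathrm{rise}_{\mathbf F}(p,U)\}\subseteq\mathrm{rise}_{\mathbf H}(p,U\setminus A)\quad\text{for every neighbourhood } U \text{ of } p \text{ in } X.$$ (2) If $\mathbf F$ is a $\pi$-tree on $X$ such that $\mathrm{cofin}\,\omega\gg\mathrm{Rise}_{\mathbf F}(X)$, then there exists a $\pi$-tree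 $\mathbf H$ on the subspace $X\setminus A$ such that $\mathrm{cofin}\{2n+1:n\in\omega\}\gg\mathrm{Rise}_{\mathbf H}(X\setminus A)$. -/

import Mathlib

open Set Topology

universe u v

/-- The family `γ` π-refines the family `δ`. -/
def PiRefines {α : Type u} (γ δ : Set (Set α)) : Prop :=
  ∀ D ∈ δ, D ≠ ∅ → ∃ G ∈ γ, G ≠ ∅ ∧ G ⊆ D

/-- The family of all sets `A \ F` with `F` a finite subset of `A`. -/
def cofin {α : Type u} (A : Set α) : Set (Set α) :=
  {B | ∃ F : Set α, F ⊆ A ∧ F.Finite ∧ B = A \ F}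

/-- A foliage tree whose leaves are subsets of `X`: a set-theoretic tree (a partial order in which
the set of strict predecessors of every node is well-ordered) together with a map that assigns to
every node its leaf. -/
structure FoliageTree (X : Type u) where
  /-- the nodes of the skeleton -/
  Node : Type v
  [order : PartialOrder Node]
  wellOrdered : ∀ x : Node, IsWellOrder (Set.Iio x) (· < ·)
  /-- the leaf at a node -/
  leaf : Node → Set X

namespace FoliageTree

variable {X : Type u}

attribute [instance] FoliageTree.order FoliageTree.wellOrdered

/-- The height of a node: the order type of the set of its strict predecessors. -/
noncomputable def height (F : FoliageTree.{u, v} X) (x : F.Node) : Ordinal.{v} :=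
  Ordinal.type (α := Set.Iio x) (· < ·)

/-- The immediate successors of a node. -/
def sons (F : FoliageTree.{u, v} X) (x : F.Node) : Set F.Node :=
  {s | x < s ∧ Set.Ioi x ∩ Set.Iio s = ∅}

/-- A branch is an inclusion-maximal chain of the skeleton. -/
def IsBranch (F : FoliageTree.{u, v} X) (B : Set F.Node) : Prop :=
  IsMaxChain (· ≤ ·) B

/-- The union of the leaves at the nodes of `C`. -/
def flesh (F : FoliageTree.{u, v} X) (C : Set F.Node) : Set X :=
  ⋃ x ∈ C, F.leaf x

/-- The family of the sets `flesh C`, where `C` is a cofinite subset of the set of sons of `x`. -/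
def shoot (F : FoliageTree.{u, v} X) (x : F.Node) : Set (Set X) :=
  {S | ∃ C ∈ cofin (F.sons x), S = F.flesh C}

/-- The set of nodes whose leaf contains `p`. -/
def scope (F : FoliageTree.{u, v} X) (p : X) : Set F.Node :=
  {x | p ∈ F.leaf x}

def HasStrictBranches (F : FoliageTree.{u, v} X) : Prop :=
  Nonempty F.Node ∧ ∀ B : Set F.Node, F.IsBranch B → ∃ a : X, (⋂ x ∈ B, F.leaf x) = {a}

/-- The leaf at every non-maximal node is the disjoint union of the leaves at its sons. -/
def IsLocallyStrict (F : FoliageTree.{u, v} X) : Prop :=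
  ∀ x : F.Node, ¬ IsMax x →
    F.leaf x = (⋃ s ∈ F.sons x, F.leaf s) ∧
    ∀ s ∈ F.sons x, ∀ t ∈ F.sons x, s ≠ t → F.leaf s ∩ F.leaf t = ∅

/-- The skeleton is isomorphic to the tree of all finite sequences of natural numbers ordered by
proper extension. -/
def IsOmegaOmegaTree (F : FoliageTree.{u, v} X) : Prop :=
  Nonempty (RelIso (fun x y : F.Node => x < y) (fun s t : List ℕ => s <+: t ∧ s ≠ t))

/-- `F` is a Baire foliage tree on the space `X`. -/
def IsBaire [TopologicalSpace X] (F : FoliageTree.{u, v} X) : Prop :=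
  (∀ x : F.Node, IsOpen (F.leaf x)) ∧
  F.IsLocallyStrict ∧
  F.IsOmegaOmegaTree ∧
  F.HasStrictBranches ∧
  ∃ r : F.Node, IsBot r ∧ F.leaf r = Set.univ

/-- `F` grows into the space `X`. -/
def GrowsInto [TopologicalSpace X] (F : FoliageTree.{u, v} X) : Prop :=
  ∀ p : X, ∀ U ∈ 𝓝 p, ∃ z ∈ F.scope p, PiRefines (F.shoot z) {U}

/-- `F` is a π-tree on the space `X`. -/
def IsPiTree [TopologicalSpace X] (F : FoliageTree.{u, v} X) : Prop :=
  F.IsBaire ∧ F.GrowsInto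

/-- The heights of the nodes `x` with `p ∈ F.leaf x` whose shoot π-refines `{U}`. -/
def rise (F : FoliageTree.{u, v} X) (p : X) (U : Set X) : Set Ordinal.{v} :=
  {α | ∃ x ∈ F.scope p, PiRefines (F.shoot x) {U} ∧ F.height x = α}

/-- All the sets `rise p U`, where `p` is a point of the space `X` and `U` a neighbourhood
of `p`. -/
def rises [TopologicalSpace X] (F : FoliageTree.{u, v} X) : Set (Set Ordinal.{v}) :=
  {R | ∃ p : X, ∃ U ∈ 𝓝 p, R = F.rise p U}

end FoliageTree

/-! Coding the skeleton by finite sequences and giving each point its branch turns a Baire foliage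
tree into a bijection of `X` with Baire space whose leaves are the cylinders
(`IsStrictScheme.exists_equiv`).

To delete `A`, take the first point `a` of `A`, in a fixed enumeration, lying in a cylinder. The
other points of the cylinder are sorted by the first coordinate at which they leave `a`; each class
is the union of all but one of the immediate subcylinders along an initial segment of `a`, its stem.
Inserting the classes as an extra level and repeating inside the subcylinders (`exists_removalRule`,
`RemovalRule`) removes every point of `A` along each branch, so a strict scheme on the complement
results.

Odd levels thus consist of classes, whose sons are, up to `A`, distinct sons of the stem. If almost
all sons of the stem lie in `U`, so do almost all sons of the class. With `f_p n` the length of the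
`n`-th stem through `p`, this is (1). Part (2) follows because an injective `f_p` pulls cofinite
sets back to cofinite sets. -/

/-! ### Initial segments and strict schemes -/

/-- The list of the first `n` values of `x`. -/
def initialSegment (x : ℕ → ℕ) (n : ℕ) : List ℕ := (List.range n).map x

@[simp] theorem length_initialSegment (x : ℕ → ℕ) (n : ℕ) : (initialSegment x n).length = n := by
  simp [initialSegment]

@[simp] theorem initialSegment_zero (x : ℕ → ℕ) : initialSegment x 0 = [] := rfl

theorem initialSegment_succ (x : ℕ → ℕ) (n : ℕ) :
    initialSegment x (n + 1) = initialSegment x n ++ [x n] := by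
  simp [initialSegment, List.range_succ]

@[simp] theorem getElem_initialSegment (x : ℕ → ℕ) (n i : ℕ) (h : i < (initialSegment x n).length) :
    (initialSegment x n)[i] = x i := by
  simp [initialSegment]

theorem initialSegment_prefix (x : ℕ → ℕ) {m n : ℕ} (h : m ≤ n) :
    initialSegment x m <+: initialSegment x n := by
  induction n, h using Nat.le_induction with
  | base => exact List.prefix_rfl
  | succ n _ ih => rw [initialSegment_succ]; exact ih.trans (List.prefix_append _ _)

theorem eq_initialSegment_of_prefix {x : ℕ → ℕ} {n : ℕ} {s : List ℕ}
    (h : s <+: initialSegment x n) : s = initialSegment x s.length := by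
  have hl : s.length ≤ n := by simpa using h.length_le
  have h' := initialSegment_prefix x hl
  have := List.prefix_of_prefix_length_le h h' (by simp)
  exact this.eq_of_length (by simp)

theorem initialSegment_eq_iff {x y : ℕ → ℕ} {n : ℕ} :
    initialSegment x n = initialSegment y n ↔ ∀ i < n, x i = y i := by
  simp [initialSegment]

/-- A system of sets indexed by the finite sequences of natural numbers in which every set is the
disjoint union of its successors and every branch has exactly one point. -/
structure IsStrictScheme {X : Type u} (L : List ℕ → Set X) : Prop where
  nil : L [] = univ
  union : ∀ s, L s = ⋃ n, L (s ++ [n])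
  disjoint : ∀ s m n, m ≠ n → L (s ++ [m]) ∩ L (s ++ [n]) = ∅
  branch : ∀ x : ℕ → ℕ, ∃ a, ⋂ n, L (initialSegment x n) = {a}

/-! ### Foliage trees coded by finite sequences -/

namespace FoliageTree

variable {X : Type u}

/-- Isomorphisms of the skeleton with the tree of finite sequences of natural numbers. -/
abbrev Coding (F : FoliageTree.{u, v} X) : Type v :=
  RelIso (fun x y : F.Node => x < y) (fun s t : List ℕ => s <+: t ∧ s ≠ t)

variable {F : FoliageTree.{u, v} X} (e : F.Coding)

theorem Coding.lt_iff (x y : F.Node) : x < y ↔ e x <+: e y ∧ e x ≠ e y :=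
  e.map_rel_iff.symm

theorem Coding.le_iff (x y : F.Node) : x ≤ y ↔ e x <+: e y := by
  rw [le_iff_lt_or_eq, e.lt_iff]
  constructor
  · rintro (h | rfl)
    · exact h.1
    · exact List.prefix_rfl
  · intro h
    by_cases h' : e x = e y
    · exact Or.inr (e.injective h')
    · exact Or.inl ⟨h, h'⟩

theorem Coding.mem_sons_iff (x s : F.Node) : s ∈ F.sons x ↔ ∃ n, e s = e x ++ [n] := by
  constructor
  · rintro ⟨h, h'⟩
    obtain ⟨⟨l, hl⟩, hne⟩ := (e.lt_iff _ _).1 h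
    match l, hl with
    | [], hl => exact absurd (by simpa using hl) hne
    | [n], hl => exact ⟨n, hl.symm⟩
    | n :: m :: l, hl =>
      exfalso
      have : e.symm (e x ++ [n]) ∈ Set.Ioi x ∩ Set.Iio s := by
        simp only [mem_inter_iff, mem_Ioi, mem_Iio, e.lt_iff, RelIso.apply_symm_apply, ← hl]
        simp
      rw [h'] at this
      exact this
  · rintro ⟨n, hn⟩
    refine ⟨(e.lt_iff _ _).2 (by simp [hn]), ?_⟩
    rw [Set.eq_empty_iff_forall_notMem]
    rintro y ⟨hy, hy'⟩
    rw [mem_Ioi, e.lt_iff] at hy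
    rw [mem_Iio, e.lt_iff] at hy'
    have h1 := hy.1.length_le
    have h2 := hy'.1.length_le
    have h3 : (e x).length ≠ (e y).length := fun h => hy.2 (hy.1.eq_of_length h)
    have h4 : (e y).length ≠ (e s).length := fun h => hy'.2 (hy'.1.eq_of_length h)
    simp only [hn, List.length_append, List.length_singleton] at h2 h4
    omega

/-- A predecessor is a proper prefix, hence determined by its length. -/
theorem Coding.height_eq (x : F.Node) : F.height x = ((e x).length : Ordinal.{v}) := by
  let g : Set.Iio x ≃ Fin (e x).length :=
    Equiv.ofBijective (fun y => ⟨(e y).length, by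
        have h := (e.lt_iff _ _).1 y.2
        exact lt_of_le_of_ne h.1.length_le fun h' => h.2 (h.1.eq_of_length h')⟩) <| by
      constructor
      · rintro ⟨y, hy⟩ ⟨z, hz⟩ h
        have h' : (e y).length = (e z).length := by simpa using h
        have hy := ((e.lt_iff _ _).1 hy).1
        have hz := ((e.lt_iff _ _).1 hz).1
        exact Subtype.ext (e.injective
          ((List.prefix_of_prefix_length_le hy hz h'.le).eq_of_length h'))
      · rintro ⟨n, hn⟩
        refine ⟨⟨e.symm ((e x).take n), (e.lt_iff _ _).2 ?_⟩, ?_⟩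
        · rw [RelIso.apply_symm_apply]
          refine ⟨List.take_prefix _ _, fun h => ?_⟩
          have := congrArg List.length h
          simp at this
          omega
        · simp only [RelIso.apply_symm_apply, List.length_take, Fin.mk.injEq]
          omega
  have : Fintype (Set.Iio x) := Fintype.ofEquiv _ g.symm
  rw [height, Ordinal.type_fintype, Fintype.card_congr g, Fintype.card_fin]

theorem Coding.isBranch_iff (B : Set F.Node) :
    F.IsBranch B ↔ ∃ x : ℕ → ℕ, B = range fun n => e.symm (initialSegment x n) := by
  have hchain : ∀ x : ℕ → ℕ,
      IsChain (· ≤ ·) (range fun n => e.symm (initialSegment x n)) := by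
    rintro x _ ⟨m, rfl⟩ _ ⟨n, rfl⟩ -
    simp only [e.le_iff, RelIso.apply_symm_apply]
    exact (le_total m n).imp (initialSegment_prefix x) (initialSegment_prefix x)
  constructor
  · intro hB
    classical
    have hget : ∀ y ∈ B, ∀ z ∈ B, ∀ i (hy : i < (e y).length) (hz : i < (e z).length),
        (e y)[i] = (e z)[i] := by
      intro y hy z hz i hiy hiz
      rcases hB.1.total hy hz with h | h
      · exact ((e.le_iff _ _).1 h).getElem hiy
      · exact (((e.le_iff _ _).1 h).getElem hiz).symm
    -- Members of a chain agree wherever both are defined, so the choice is immaterial. The default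
    -- 0 makes `x` total; maximality of `B` then absorbs the resulting branch.
    let x : ℕ → ℕ := fun n =>
      if h : ∃ y ∈ B, n < (e y).length then (e h.choose)[n]'h.choose_spec.2 else 0
    refine ⟨x, hB.2 (hchain x) ?_⟩
    intro y hy
    refine ⟨(e y).length, ?_⟩
    rw [← e.injective.eq_iff]
    simp only [RelIso.apply_symm_apply]
    refine List.ext_getElem (by simp) fun i h1 h2 => ?_
    have h : ∃ y ∈ B, i < (e y).length := ⟨y, hy, h2⟩
    rw [getElem_initialSegment]
    simp only [x, dif_pos h]
    exact hget _ h.choose_spec.1 _ hy _ _ _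
  · rintro ⟨x, rfl⟩
    refine ⟨hchain x, fun t ht hsub => hsub.antisymm fun y hy => ?_⟩
    refine ⟨(e y).length, ?_⟩
    have hm := hsub ⟨(e y).length, rfl⟩
    rw [← e.injective.eq_iff]
    rcases ht.total hm hy with h | h
    · refine ((e.le_iff _ _).1 h).eq_of_length (by simp)
    · exact (((e.le_iff _ _).1 h).eq_of_length (by simp)).symm

theorem Coding.not_isMax (e : F.Coding) (x : F.Node) : ¬ IsMax x := by
  intro h
  have : x < e.symm (e x ++ [0]) := (e.lt_iff _ _).2 (by simp)
  exact h.not_lt this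

theorem Coding.sons_eq (x : F.Node) : F.sons x = range fun n => e.symm (e x ++ [n]) := by
  ext s
  rw [e.mem_sons_iff]
  refine exists_congr fun n => ?_
  rw [← e.injective.eq_iff, RelIso.apply_symm_apply, eq_comm]

theorem Coding.isBaire_iff (e : F.Coding) [TopologicalSpace X] :
    F.IsBaire ↔ (∀ s, IsOpen (F.leaf (e.symm s))) ∧ IsStrictScheme fun s => F.leaf (e.symm s) := by
  have hbot : IsBot (e.symm []) := fun y => (e.le_iff _ _).2 (by simp)
  constructor
  · rintro ⟨h1, h2, -, h4, r, hr, hr'⟩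
    refine ⟨fun s => h1 _, ⟨?_, fun s => ?_, fun s m n hmn => ?_, fun x => ?_⟩⟩
    · rw [← hr', (hr _).antisymm (hbot r)]
    · have := (h2 (e.symm s) (e.not_isMax _)).1
      simpa [e.sons_eq] using this
    · refine (h2 (e.symm s) (e.not_isMax _)).2 _ ?_ _ ?_ ?_
      · simp [e.mem_sons_iff]
      · simp [e.mem_sons_iff]
      · simpa [e.symm.injective.eq_iff] using hmn
    · obtain ⟨a, ha⟩ := h4.2 _ ((e.isBranch_iff _).2 ⟨x, rfl⟩)
      exact ⟨a, by simpa using ha⟩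
  · rintro ⟨ho, h⟩
    refine ⟨fun x => by simpa using ho (e x), fun x _ => ⟨?_, ?_⟩, ⟨e⟩, ⟨⟨e.symm []⟩, ?_⟩,
      e.symm [], hbot, h.nil⟩
    · have := h.union (e x)
      simpa [e.sons_eq] using this
    · rw [e.sons_eq]
      rintro _ ⟨m, rfl⟩ _ ⟨n, rfl⟩ hmn
      exact h.disjoint _ _ _ fun h' => hmn (by rw [h'])
    · intro B hB
      obtain ⟨x, rfl⟩ := (e.isBranch_iff _).1 hB
      simpa using h.branch x

/-- Reduces refinement by a shoot to a count of bad sons. Nonempty leaves are needed because a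
refining set must itself be nonempty. -/
theorem Coding.piRefines_shoot_iff (x : F.Node) (hx : ∀ s, (F.leaf (e.symm s)).Nonempty)
    {U : Set X} (hU : U.Nonempty) :
    PiRefines (F.shoot x) {U} ↔ {n | ¬ F.leaf (e.symm (e x ++ [n])) ⊆ U}.Finite := by
  have hinj : Function.Injective fun n => e.symm (e x ++ [n]) := fun m n h => by
    simpa using e.symm.injective h
  constructor
  · intro h
    obtain ⟨_, ⟨_, ⟨K, -, hK, rfl⟩, rfl⟩, -, hG⟩ := h U rfl hU.ne_empty
    refine (hK.preimage hinj.injOn).subset fun n hn => ?_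
    by_contra hn'
    refine hn ((Set.subset_biUnion_of_mem (u := F.leaf) ?_).trans hG)
    exact ⟨by simp [e.mem_sons_iff], hn'⟩
  · rintro h D rfl -
    refine ⟨_, ⟨_, ⟨(fun n => e.symm (e x ++ [n])) '' _, ?_, h.image _, rfl⟩, rfl⟩, ?_, ?_⟩
    · rw [e.sons_eq]; exact image_subset_range _ _
    · obtain ⟨n, hn⟩ := h.infinite_compl.nonempty
      obtain ⟨q, hq⟩ := hx (e x ++ [n])
      refine Set.Nonempty.ne_empty ⟨q, mem_biUnion (x := e.symm (e x ++ [n])) ⟨?_, ?_⟩ hq⟩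
      · simp [e.mem_sons_iff]
      · rintro ⟨m, hm, hmn⟩
        exact hn (hinj hmn ▸ hm)
    · refine iUnion₂_subset ?_
      rintro s ⟨hs, hs'⟩
      obtain ⟨n, rfl⟩ := (e.sons_eq x) ▸ hs
      by_contra hn
      exact hs' ⟨n, hn, rfl⟩

end FoliageTree

/-! ### Strict schemes as cylinders of Baire space -/

theorem IsStrictScheme.exists_branch {X : Type u} {L : List ℕ → Set X} (h : IsStrictScheme L)
    (q : X) : ∃ x : ℕ → ℕ, ∀ n, q ∈ L (initialSegment x n) := by
  have hs : ∀ s : {s // q ∈ L s}, ∃ n, q ∈ L (s.1 ++ [n]) := fun s => by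
    have := s.2
    rw [h.union] at this
    exact mem_iUnion.1 this
  choose c hc using hs
  let l : ℕ → {s // q ∈ L s} := fun n =>
    Nat.rec ⟨[], h.nil ▸ mem_univ q⟩ (fun _ s => ⟨s.1 ++ [c s], hc s⟩) n
  have hl : ∀ n, initialSegment (fun n => c (l n)) n = (l n).1 := fun n => by
    induction n with
    | zero => rfl
    | succ n ih => rw [initialSegment_succ, ih]
  exact ⟨fun n => c (l n), fun n => hl n ▸ (l n).2⟩

theorem IsStrictScheme.append_subset {X : Type u} {L : List ℕ → Set X} (h : IsStrictScheme L)
    (s : List ℕ) (n : ℕ) : L (s ++ [n]) ⊆ L s := by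
  rw [h.union s]
  exact subset_iUnion (fun n => L (s ++ [n])) n

theorem IsStrictScheme.initialSegment_eq {X : Type u} {L : List ℕ → Set X} (h : IsStrictScheme L)
    {q : X} {x y : ℕ → ℕ} {n : ℕ} (hx : q ∈ L (initialSegment x n))
    (hy : q ∈ L (initialSegment y n)) : initialSegment x n = initialSegment y n := by
  induction n with
  | zero => rfl
  | succ n ih =>
    rw [initialSegment_succ] at hx hy ⊢
    rw [initialSegment_succ]
    have := ih (h.append_subset _ _ hx) (h.append_subset _ _ hy)
    rw [this] at hx ⊢
    by_contra hne
    have hd := h.disjoint (initialSegment y n) (x n) (y n) fun h' => hne (by rw [h'])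
    exact (hd ▸ ⟨hx, hy⟩ : q ∈ (∅ : Set X))

/-- The set of points whose address under `b` extends `s`. -/
def cylinder {X : Type u} (b : X → ℕ → ℕ) (s : List ℕ) : Set X :=
  {q | initialSegment (b q) s.length = s}

theorem eq_initialSegment_getD (s : List ℕ) :
    s = initialSegment (fun i => s.getD i 0) s.length := by
  refine List.ext_getElem (by simp) fun i h1 h2 => ?_
  simp [h1]

/-- The address map is injective since a branch has at most one point, and surjective since it has
at least one and addresses are unique. -/
theorem IsStrictScheme.exists_equiv {X : Type u} {L : List ℕ → Set X} (h : IsStrictScheme L) :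
    ∃ b : X ≃ (ℕ → ℕ), ∀ s, L s = cylinder b s := by
  choose b hb using h.exists_branch
  have hbij : Function.Bijective b := by
    constructor
    · intro p q hpq
      obtain ⟨a, ha⟩ := h.branch (b p)
      have h1 : p ∈ ({a} : Set X) := ha ▸ mem_iInter.2 (hb p)
      have h2 : q ∈ ({a} : Set X) := ha ▸ mem_iInter.2 (hpq ▸ hb q)
      rw [mem_singleton_iff.1 h1, mem_singleton_iff.1 h2]
    · intro x
      obtain ⟨a, ha⟩ := h.branch x
      have h1 : a ∈ ⋂ n, L (initialSegment x n) := ha ▸ mem_singleton a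
      refine ⟨a, funext fun n => ?_⟩
      exact initialSegment_eq_iff.1
        (h.initialSegment_eq (hb a (n + 1)) (mem_iInter.1 h1 (n + 1))) n n.lt_succ_self
  refine ⟨Equiv.ofBijective b hbij, fun s => Set.ext fun q => ⟨fun hq => ?_, fun hq => ?_⟩⟩
  · rw [eq_initialSegment_getD s] at hq
    exact (h.initialSegment_eq (hb q _) hq).trans (eq_initialSegment_getD s).symm
  · have : initialSegment (b q) s.length = s := hq
    exact this ▸ hb q s.length

/-! ### Splitting a cylinder around a point of `A` -/

section Cylinder

variable {X : Type u} {b : X → ℕ → ℕ}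

theorem cylinder_anti {s t : List ℕ} (h : s <+: t) : cylinder b t ⊆ cylinder b s := fun q hq => by
  have hq : initialSegment (b q) t.length = t := hq
  rw [← hq] at h
  exact (eq_initialSegment_of_prefix h).symm

theorem mem_cylinder_append {q : X} {s : List ℕ} {n : ℕ} :
    q ∈ cylinder b (s ++ [n]) ↔ q ∈ cylinder b s ∧ b q s.length = n := by
  simp [cylinder, initialSegment_succ]

theorem mem_cylinder_initialSegment {q : X} {x : ℕ → ℕ} {n : ℕ} :
    q ∈ cylinder b (initialSegment x n) ↔ ∀ i < n, b q i = x i := by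
  simp [cylinder, initialSegment_eq_iff]

/-- A rule that splits every cylinder `cylinder b s`, up to points of `A`, into pieces indexed by
`i`, each of which is a union of immediate subcylinders of `cylinder b (stem s i)`, in such a way
that iterated splitting excludes all points of `A`. -/
structure RemovalRule (b : X → ℕ → ℕ) (A : Set X) where
  /-- the common stem of the subcylinders of a piece -/
  stem : List ℕ → ℕ → List ℕ
  /-- the last entries of the subcylinders of a piece -/
  last : List ℕ → ℕ → ℕ → ℕ
  prefix_stem : ∀ s i, s <+: stem s i
  last_injective : ∀ s i, Function.Injective (last s i)
  exists_mem : ∀ s, ∀ q ∉ A, q ∈ cylinder b s → ∃ i j, q ∈ cylinder b (stem s i ++ [last s i j])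
  index_unique : ∀ s, ∀ q, ∀ i j i' j', q ∈ cylinder b (stem s i ++ [last s i j]) →
    q ∈ cylinder b (stem s i' ++ [last s i' j']) → i = i'
  excludes : ∀ S : ℕ → List ℕ, (∀ k, ∃ i j, S (k + 1) = stem (S k) i ++ [last (S k) i j]) →
    ∀ a ∈ A, ∃ k, a ∉ cylinder b (S k)

/-- Around the point of `A` of least code, split by the first coordinate of disagreement; a cylinder
missing `A` is split into its sons. The least code strictly grows along a branch, so no point of `A`
survives. -/
theorem exists_removalRule (hb : Function.Injective b) {A : Set X} (hA : A.Countable) :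
    Nonempty (RemovalRule b A) := by
  classical
  obtain ⟨enc, henc⟩ := Set.countable_iff_exists_injOn.1 hA
  have hpick : ∀ s, (A ∩ cylinder b s).Nonempty →
      ∃ a ∈ A ∩ cylinder b s, ∀ a' ∈ A ∩ cylinder b s, enc a ≤ enc a' := fun s hs => by
    obtain ⟨a, ha, hmin⟩ := (InvImage.wf enc Nat.lt_wfRel.wf).has_min _ hs
    exact ⟨a, ha, fun a' ha' => not_lt.1 (hmin a' ha')⟩
  choose pick hpick hmin using hpick
  refine ⟨{
    stem := fun s i => if h : (A ∩ cylinder b s).Nonempty then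
      initialSegment (b (pick s h)) (s.length + i) else s ++ [i]
    last := fun s i j => if h : (A ∩ cylinder b s).Nonempty then
      -- Enumerates all naturals except the value taken by the deleted point.
      (if j < b (pick s h) (s.length + i) then j else j + 1) else j
    prefix_stem := fun s i => ?_
    last_injective := fun s i j j' hj => ?_
    exists_mem := fun s q hqA hq => ?_
    index_unique := fun s q i j i' j' h1 h2 => ?_
    excludes := fun S hS a haA => ?_ }⟩
  · split_ifs with h
    · have h1 : initialSegment (b (pick s h)) s.length = s := (hpick s h).2
      conv_lhs => rw [← h1]
      exact initialSegment_prefix _ (by omega)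
    · exact List.prefix_append _ _
  · dsimp only at hj
    split_ifs at hj <;> omega
  · by_cases h : (A ∩ cylinder b s).Nonempty
    · simp only [dif_pos h]
      have hne : ∃ k, b q k ≠ b (pick s h) k := by
        by_contra! hc
        exact hqA (hb (funext hc) ▸ (hpick s h).1)
      have hk := Nat.find_spec hne
      have hlt : ∀ i < Nat.find hne, b q i = b (pick s h) i := fun i hi => by
        simpa using Nat.find_min hne hi
      generalize Nat.find hne = k at hk hlt
      have hsk : s.length ≤ k := by
        by_contra! hc
        have h1 : initialSegment (b q) s.length = s := hq
        have h2 : initialSegment (b (pick s h)) s.length = s := (hpick s h).2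
        exact hk (initialSegment_eq_iff.1 (h1.trans h2.symm) k hc)
      obtain ⟨i, rfl⟩ := Nat.exists_eq_add_of_le hsk
      -- The second witness inverts the enumeration that skips one value.
      refine ⟨i, if b q (s.length + i) < b (pick s h) (s.length + i) then b q (s.length + i)
        else b q (s.length + i) - 1, ?_⟩
      rw [mem_cylinder_append, mem_cylinder_initialSegment, length_initialSegment]
      refine ⟨hlt, ?_⟩
      split_ifs <;> omega
    · simp only [dif_neg h]
      refine ⟨b q s.length, b q (s.length + 1), ?_⟩
      rw [mem_cylinder_append, mem_cylinder_append]
      simp [hq]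
  · by_cases h : (A ∩ cylinder b s).Nonempty
    · simp only [dif_pos h, mem_cylinder_append, mem_cylinder_initialSegment,
        length_initialSegment] at h1 h2
      have key : ∀ i i' j, (∀ k < s.length + i', b q k = b (pick s h) k) →
          b q (s.length + i) = (if j < b (pick s h) (s.length + i) then j else j + 1) →
          i' ≤ i := fun i i' j h1 h2 => by
        by_contra! hc
        rw [h1 _ (by omega)] at h2
        split_ifs at h2 <;> omega
      exact le_antisymm (key _ _ _ h1.1 h2.2) (key _ _ _ h2.1 h1.2)
    · simp only [dif_neg h, mem_cylinder_append] at h1 h2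
      exact h1.1.2.symm.trans h2.1.2
  · by_contra! hc
    have hne : ∀ k, (A ∩ cylinder b (S k)).Nonempty := fun k => ⟨a, haA, hc k⟩
    have hlt : ∀ k, enc (pick _ (hne k)) < enc (pick _ (hne (k + 1))) := fun k => by
      obtain ⟨i, j, hij⟩ := hS k
      have hp := hpick _ (hne (k + 1))
      simp only [dif_pos (hne k)] at hij
      generalize pick _ (hne (k + 1)) = c at hp ⊢
      have hmem := hp.2
      rw [hij, mem_cylinder_append, mem_cylinder_initialSegment, length_initialSegment] at hmem
      have hs : c ∈ cylinder b (S k) := by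
        have h1 : initialSegment (b (pick _ (hne k))) (S k).length = S k := (hpick _ (hne k)).2
        exact (initialSegment_eq_iff.2 fun l hl => hmem.1 l (by omega)).trans h1
      -- The new least point also lies in the old cylinder; equal codes would make it the deleted
      -- point, which the skipped value forbids.
      refine lt_of_le_of_ne (hmin _ (hne k) _ ⟨hp.1, hs⟩) fun heq => ?_
      have := henc (hpick _ (hne k)).1 hp.1 heq
      have h2 := hmem.2
      rw [← this] at h2
      split_ifs at h2 <;> omega
    have hmono := strictMono_nat_of_lt_succ (f := fun k => enc (pick _ (hne k))) hlt
    have h1 := hmono.le_apply (x := enc a + 1)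
    have h2 := hmin _ (hne (enc a + 1)) a ⟨haA, hc _⟩
    omega

/-! ### Iterated splitting: the scheme on the complement -/

namespace RemovalRule

variable {A : Set X} (R : RemovalRule b A)

/-- One step of the iterated splitting: a state is either a cylinder or a piece of one. -/
def step : List ℕ ⊕ List ℕ × ℕ → ℕ → List ℕ ⊕ List ℕ × ℕ
  | .inl s, i => .inr (s, i)
  | .inr (s, i), j => .inl (R.stem s i ++ [R.last s i j])

/-- The state reached along a sequence of indices. -/
def run (u : List ℕ) : List ℕ ⊕ List ℕ × ℕ := u.foldl R.step (.inl [])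

/-- The set of points described by a state. -/
def stateSet : List ℕ ⊕ List ℕ × ℕ → Set X
  | .inl s => cylinder b s
  | .inr (s, i) => ⋃ j, cylinder b (R.stem s i ++ [R.last s i j])

/-- The scheme on the complement of `A` obtained by iterated splitting. -/
def scheme (u : List ℕ) : Set ↥(Aᶜ) := Subtype.val ⁻¹' R.stateSet (R.run u)

theorem run_append (u : List ℕ) (n : ℕ) : R.run (u ++ [n]) = R.step (R.run u) n := by
  simp [run]

theorem scheme_union (u : List ℕ) : R.scheme u = ⋃ n, R.scheme (u ++ [n]) := by
  simp only [scheme, run_append]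
  rcases R.run u with s | ⟨s, i⟩
  · ext ⟨q, hq⟩
    simp only [stateSet, step, mem_preimage, mem_iUnion]
    refine ⟨R.exists_mem s q hq, ?_⟩
    rintro ⟨i, j, h⟩
    exact cylinder_anti ((R.prefix_stem s i).trans (List.prefix_append _ _)) h
  · simp only [stateSet, step, preimage_iUnion]

theorem scheme_disjoint (u : List ℕ) (m n : ℕ) (hmn : m ≠ n) :
    R.scheme (u ++ [m]) ∩ R.scheme (u ++ [n]) = ∅ := by
  simp only [scheme, run_append]
  rw [Set.eq_empty_iff_forall_notMem]
  rintro ⟨q, hq⟩ ⟨h1, h2⟩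
  generalize R.run u = w at h1 h2
  rcases w with s | ⟨s, i⟩
  · simp only [stateSet, step, mem_preimage, mem_iUnion] at h1 h2
    obtain ⟨j, h1⟩ := h1
    obtain ⟨j', h2⟩ := h2
    exact hmn (R.index_unique _ _ _ _ _ _ h1 h2)
  · simp only [stateSet, step, mem_preimage, mem_cylinder_append] at h1 h2
    exact hmn (R.last_injective _ _ (h1.2.symm.trans h2.2))

/-- The cylinders visited along an infinite sequence of indices. -/
def visit (x : ℕ → ℕ) : ℕ → List ℕ
  | 0 => []
  | k + 1 => R.stem (visit x k) (x (2 * k)) ++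
      [R.last (visit x k) (x (2 * k)) (x (2 * k + 1))]

theorem run_even (x : ℕ → ℕ) (k : ℕ) : R.run (initialSegment x (2 * k)) = .inl (R.visit x k) := by
  induction k with
  | zero => rfl
  | succ k ih =>
    rw [show 2 * (k + 1) = 2 * k + 1 + 1 by ring, initialSegment_succ, run_append,
      initialSegment_succ, run_append, ih]
    rfl

theorem run_odd (x : ℕ → ℕ) (k : ℕ) :
    R.run (initialSegment x (2 * k + 1)) = .inr (R.visit x k, x (2 * k)) := by
  rw [initialSegment_succ, run_append, run_even]
  rfl

theorem visit_prefix_stem (x : ℕ → ℕ) (k : ℕ) :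
    R.visit x k <+: R.stem (R.visit x k) (x (2 * k)) := R.prefix_stem _ _

theorem visit_prefix {m n : ℕ} (x : ℕ → ℕ) (h : m ≤ n) : R.visit x m <+: R.visit x n := by
  induction n, h using Nat.le_induction with
  | base => exact List.prefix_rfl
  | succ n _ ih => exact ih.trans ((R.visit_prefix_stem x n).trans (List.prefix_append _ _))

theorem le_length_visit (x : ℕ → ℕ) (k : ℕ) : k ≤ (R.visit x k).length := by
  induction k with
  | zero => simp
  | succ k ih =>
    have := (R.visit_prefix_stem x k).length_le
    simp only [visit, List.length_append, List.length_singleton]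
    omega

theorem scheme_branch (hb : Function.Bijective b) (x : ℕ → ℕ) :
    ∃ a, ⋂ n, R.scheme (initialSegment x n) = {a} := by
  -- The limit of the visited sequences: the `(n + 1)`-st has length at least `n + 1`, so entry `n`
  -- exists.
  let z : ℕ → ℕ := fun n => (R.visit x (n + 1))[n]'(R.le_length_visit x (n + 1))
  have hz : ∀ k, R.visit x k = initialSegment z (R.visit x k).length := fun k => by
    refine List.ext_getElem (by simp) fun i h1 h2 => ?_
    rw [getElem_initialSegment]
    rcases le_total k (i + 1) with h | h
    · exact (R.visit_prefix x h).getElem h1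
    · exact ((R.visit_prefix x h).getElem (R.le_length_visit x (i + 1))).symm
  obtain ⟨q, hq⟩ := hb.2 z
  have hqmem : ∀ k, q ∈ cylinder b (R.visit x k) := fun k => by
    rw [hz k, mem_cylinder_initialSegment, hq]
    exact fun _ _ => rfl
  have hqA : q ∉ A := fun hA => by
    obtain ⟨k, hk⟩ := R.excludes (R.visit x) (fun k => ⟨_, _, rfl⟩) q hA
    exact hk (hqmem k)
  refine ⟨⟨q, hqA⟩, Set.ext fun p => ?_⟩
  rw [mem_iInter, mem_singleton_iff]
  constructor
  · intro hp
    refine Subtype.ext (hb.1 (funext fun n => ?_))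
    have h := hp (2 * (n + 1))
    rw [scheme, run_even] at h
    have h : p.1 ∈ cylinder b (R.visit x (n + 1)) := h
    rw [hz, mem_cylinder_initialSegment] at h
    rw [h n (R.le_length_visit x (n + 1)), hq]
  · rintro rfl n
    rcases Nat.even_or_odd' n with ⟨k, rfl | rfl⟩
    · rw [scheme, run_even]
      exact hqmem k
    · rw [scheme, run_odd]
      exact mem_iUnion.2 ⟨x (2 * k + 1), hqmem (k + 1)⟩

theorem isStrictScheme (hb : Function.Bijective b) : IsStrictScheme R.scheme where
  nil := by simp [scheme, run, stateSet, cylinder]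
  union := R.scheme_union
  disjoint := R.scheme_disjoint
  branch := R.scheme_branch hb

theorem isOpen_scheme [TopologicalSpace X] (hb : ∀ s, IsOpen (cylinder b s)) (u : List ℕ) :
    IsOpen (R.scheme u) := by
  refine IsOpen.preimage continuous_subtype_val ?_
  rcases R.run u with s | ⟨s, i⟩
  · exact hb s
  · exact isOpen_iUnion fun j => hb _

/-- Compares odd levels with the old tree: sons of the class `u k` are traces of distinct sons of
the stem `t k`. Stem lengths increase because each visited cylinder properly extends the previous
stem. -/
theorem exists_stems (hb : Function.Bijective b) (p : ↥(Aᶜ)) :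
    ∃ (u t : ℕ → List ℕ) (g : ℕ → ℕ → ℕ), StrictMono (fun k => (t k).length) ∧ ∀ k,
      (u k).length = 2 * k + 1 ∧ p ∈ R.scheme (u k) ∧ p.1 ∈ cylinder b (t k) ∧
      Function.Injective (g k) ∧
      ∀ j, R.scheme (u k ++ [j]) = Subtype.val ⁻¹' cylinder b (t k ++ [g k j]) := by
  obtain ⟨x, hx⟩ := (R.isStrictScheme hb).exists_branch p
  refine ⟨fun k => initialSegment x (2 * k + 1), fun k => R.stem (R.visit x k) (x (2 * k)),
    fun k => R.last (R.visit x k) (x (2 * k)), strictMono_nat_of_lt_succ fun k => ?_, fun k =>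
    ⟨by simp, hx _, ?_, R.last_injective _ _, fun j => ?_⟩⟩
  · have := (R.visit_prefix_stem x (k + 1)).length_le
    conv_lhs at this => simp only [visit, List.length_append, List.length_singleton]
    dsimp only
    omega
  · have h := hx (2 * (k + 1))
    rw [scheme, run_even] at h
    exact cylinder_anti (List.prefix_append _ _) h
  · rw [scheme, run_append, run_odd]
    rfl

end RemovalRule

end Cylinder

/-! ### The tree of finite sequences in an arbitrary universe -/

/-- The finite sequences of natural numbers, ordered by extension. -/
structure SequenceNode : Type v where
  /-- the underlying sequence -/
  seq : ULift.{v} (List ℕ)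

namespace SequenceNode

instance : PartialOrder SequenceNode.{v} where
  le s t := s.seq.down <+: t.seq.down
  le_refl _ := List.prefix_rfl
  le_trans _ _ _ := List.IsPrefix.trans
  le_antisymm := by
    rintro ⟨⟨s⟩⟩ ⟨⟨t⟩⟩ h h'
    have : s = t := h.eq_of_length (le_antisymm h.length_le h'.length_le)
    rw [this]

theorem le_iff (s t : SequenceNode.{v}) : s ≤ t ↔ s.seq.down <+: t.seq.down := Iff.rfl

/-- Nodes are the same as finite sequences. -/
def equiv : SequenceNode.{v} ≃ List ℕ where
  toFun s := s.seq.down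
  invFun s := ⟨⟨s⟩⟩
  left_inv _ := rfl
  right_inv _ := rfl

theorem lt_iff (s t : SequenceNode.{v}) : s < t ↔ equiv s <+: equiv t ∧ equiv s ≠ equiv t := by
  rw [lt_iff_le_and_ne, equiv.injective.ne_iff]
  rfl

theorem isWellOrder_Iio (x : SequenceNode.{v}) : IsWellOrder (Set.Iio x) (· < ·) := by
  have hwf : WellFounded ((· < ·) : Set.Iio x → Set.Iio x → Prop) := by
    refine Subrelation.wf (r := InvImage (· < ·) fun y => (equiv y.1).length) ?_
      (InvImage.wf _ Nat.lt_wfRel.wf)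
    intro y z h
    have h := (lt_iff _ _).1 h
    exact lt_of_le_of_ne h.1.length_le fun h' => h.2 (h.1.eq_of_length h')
  have : Std.Trichotomous ((· < ·) : Set.Iio x → Set.Iio x → Prop) := ⟨by
    rintro ⟨y, hy⟩ ⟨z, hz⟩ h h'
    have hyz : y ≤ z ∨ z ≤ y :=
      List.prefix_or_prefix_of_prefix ((le_iff _ _).1 (le_of_lt hy)) ((le_iff _ _).1 (le_of_lt hz))
    refine Subtype.ext ?_
    rcases hyz with hyz | hyz
    · exact hyz.eq_of_not_lt h
    · exact (hyz.eq_of_not_lt h').symm⟩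
  exact { wf := hwf }

end SequenceNode

/-! ### Building the new foliage tree -/

namespace FoliageTree

variable {X : Type u}

/-- The foliage tree of all finite sequences with prescribed leaves. -/
def ofScheme (L : List ℕ → Set X) : FoliageTree.{u, v} X where
  Node := SequenceNode.{v}
  wellOrdered := SequenceNode.isWellOrder_Iio
  leaf s := L (SequenceNode.equiv s)

/-- The tautological coding of `ofScheme L`. -/
def codingOfScheme (L : List ℕ → Set X) : (ofScheme.{u, v} L).Coding where
  toEquiv := SequenceNode.equiv
  map_rel_iff' := (SequenceNode.lt_iff _ _).symm

theorem IsBaire.leaf_nonempty [TopologicalSpace X] {F : FoliageTree.{u, v} X} (hF : F.IsBaire)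
    (e : F.Coding) (s : List ℕ) : (F.leaf (e.symm s)).Nonempty := by
  obtain ⟨a, ha⟩ := (e.isBaire_iff.1 hF).2.branch fun i => s.getD i 0
  have := mem_iInter.1 (ha ▸ mem_singleton a : a ∈ ⋂ n, _) s.length
  rw [← eq_initialSegment_getD] at this
  exact ⟨a, this⟩

/-- After removing countably many points from a Baire foliage tree, the rises of the new tree
contain, up to a thinning of the heights, the rises of the old one at odd places. -/
theorem IsBaire.exists_compl [TopologicalSpace X] {F : FoliageTree.{u, v} X} (hF : F.IsBaire)
    {A : Set X} (hA : A.Countable) :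
    ∃ H : FoliageTree.{u, v} ↥(Aᶜ), H.IsBaire ∧
      ∀ p : ↥(Aᶜ), ∃ f : ℕ → ℕ, StrictMono f ∧
        ∀ U ∈ 𝓝 (p : X),
          {α : Ordinal.{v} | ∃ n : ℕ, α = ((2 * n + 1 : ℕ) : Ordinal.{v}) ∧
              ((f n : ℕ) : Ordinal.{v}) ∈ F.rise (p : X) U} ⊆
            H.rise p ((Subtype.val : ↥(Aᶜ) → X) ⁻¹' U) := by
  obtain ⟨e : F.Coding⟩ := hF.2.2.1
  have hFe := e.isBaire_iff.1 hF
  obtain ⟨b, hb⟩ := hFe.2.exists_equiv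
  obtain ⟨R⟩ := exists_removalRule b.injective hA
  have hH : (ofScheme.{u, v} R.scheme).IsBaire :=
    (codingOfScheme R.scheme).isBaire_iff.2
      ⟨R.isOpen_scheme fun s => hb s ▸ hFe.1 s, R.isStrictScheme b.bijective⟩
  refine ⟨_, hH, fun p => ?_⟩
  obtain ⟨u, t, g, hmono, h⟩ := R.exists_stems b.bijective p
  refine ⟨_, hmono, fun U hU => ?_⟩
  rintro _ ⟨k, rfl, x, hx, hxU, hheight⟩
  obtain ⟨hu, hpu, hpt, hg, hsons⟩ := h k
  have hpU : p.1 ∈ U := mem_of_mem_nhds hU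
  have hlen : (e x).length = (t k).length := by
    rw [e.height_eq] at hheight
    exact_mod_cast hheight
  -- Only one node of each height has `p` in its leaf.
  have hext : e x = t k := by
    have h1 : p.1 ∈ F.leaf (e.symm (e x)) := by rwa [RelIso.symm_apply_apply]
    rw [hb] at h1
    exact (h1 : initialSegment _ _ = _).symm.trans ((congrArg _ hlen).trans hpt)
  have hfin := (e.piRefines_shoot_iff x (hF.leaf_nonempty e) ⟨_, hpU⟩).1 hxU
  simp only [hb, hext] at hfin
  refine ⟨(codingOfScheme R.scheme).symm (u k), hpu, ?_, ?_⟩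
  · rw [(codingOfScheme R.scheme).piRefines_shoot_iff _ (hH.leaf_nonempty _) ⟨p, hpU⟩]
    -- Bad sons of the class inject into bad sons of the stem.
    refine (hfin.preimage hg.injOn).subset fun j hj hj' => hj ?_
    rw [RelIso.apply_symm_apply]
    have h1 : (ofScheme R.scheme).leaf ((codingOfScheme.{u, v} R.scheme).symm (u k ++ [j])) =
      R.scheme (u k ++ [j]) := rfl
    rw [h1, hsons]
    exact preimage_mono hj'
  · rw [(codingOfScheme R.scheme).height_eq, RelIso.apply_symm_apply, hu]

end FoliageTree

/-! ### The theorem -/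

theorem mainTheorem7 {X : Type u} [TopologicalSpace X] (F : FoliageTree.{u, v} X)
    (A : Set X) (hA : A.Countable) :
    (F.IsBaire →
      ∃ H : FoliageTree.{u, v} ↥(Aᶜ), H.IsBaire ∧
        ∀ p : ↥(Aᶜ), ∃ f : ℕ → ℕ, StrictMono f ∧
          ∀ U ∈ 𝓝 (p : X),
            {α : Ordinal.{v} | ∃ n : ℕ, α = ((2 * n + 1 : ℕ) : Ordinal.{v}) ∧
                ((f n : ℕ) : Ordinal.{v}) ∈ F.rise (p : X) U} ⊆
              H.rise p ((Subtype.val : ↥(Aᶜ) → X) ⁻¹' U)) ∧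
    (F.IsPiTree →
      PiRefines (cofin (Set.Iio Ordinal.omega0.{v})) F.rises →
      ∃ H : FoliageTree.{u, v} ↥(Aᶜ), H.IsPiTree ∧
        PiRefines
          (cofin (Set.range fun n : ℕ => ((2 * n + 1 : ℕ) : Ordinal.{v})))
          H.rises) := by
  refine ⟨fun hF => hF.exists_compl hA, fun hF hrise => ?_⟩
  obtain ⟨H, hH, hp⟩ := hF.1.exists_compl hA
  have key : ∀ p : ↥(Aᶜ), ∀ V ∈ 𝓝 p, ∃ K : Set ℕ, K.Finite ∧
      ∀ n ∉ K, ((2 * n + 1 : ℕ) : Ordinal.{v}) ∈ H.rise p V := by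
    intro p V hV
    obtain ⟨f, hf, hfU⟩ := hp p
    obtain ⟨U, hU, hUV⟩ := mem_nhds_subtype _ _ _ |>.1 hV
    obtain ⟨x, hx, hxU⟩ := hF.2 p U hU
    -- π-refinement says nothing about empty rises; growth of `F` into `X` rules them out.
    have hne : F.rise p U ≠ ∅ := Set.Nonempty.ne_empty ⟨_, x, hx, hxU, rfl⟩
    obtain ⟨_, ⟨K, -, hK, rfl⟩, -, hsub⟩ := hrise _ ⟨p, U, hU, rfl⟩ hne
    have hinj : Function.Injective fun n => ((f n : ℕ) : Ordinal.{v}) :=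
      Nat.cast_injective.comp hf.injective
    refine ⟨_, hK.preimage hinj.injOn, fun n hn => ?_⟩
    obtain ⟨y, hy, hyU, hyh⟩ := hfU U hU ⟨n, rfl, hsub ⟨Ordinal.natCast_lt_omega0 _, hn⟩⟩
    refine ⟨y, hy, ?_, hyh⟩
    -- Refinement passes from the trace of `U` to the larger set `V`.
    rintro D rfl -
    obtain ⟨G, hG, hG0, hGU⟩ := hyU _ rfl
      (Set.Nonempty.ne_empty ⟨p, mem_preimage.2 (mem_of_mem_nhds hU)⟩)
    exact ⟨G, hG, hG0, hGU.trans hUV⟩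
  refine ⟨H, ⟨hH, fun p V hV => ?_⟩, ?_⟩
  · obtain ⟨K, hK, h⟩ := key p V hV
    obtain ⟨n, hn⟩ := hK.infinite_compl.nonempty
    obtain ⟨x, hx, hxV, -⟩ := h n hn
    exact ⟨x, hx, hxV⟩
  · rintro _ ⟨p, V, hV, rfl⟩ -
    obtain ⟨K, hK, h⟩ := key p V hV
    refine ⟨_, ⟨(fun n : ℕ => ((2 * n + 1 : ℕ) : Ordinal.{v})) '' K, image_subset_range _ _,
      hK.image _, rfl⟩, ?_, ?_⟩
    · obtain ⟨n, hn⟩ := hK.infinite_compl.nonempty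
      refine Set.Nonempty.ne_empty ⟨_, ⟨n, rfl⟩, ?_⟩
      rintro ⟨m, hm, hmn⟩
      have : m = n := by
        have := Nat.cast_injective (R := Ordinal.{v}) hmn
        omega
      exact hn (this ▸ hm)
    · rintro _ ⟨⟨n, rfl⟩, hn⟩
      exact h n fun hnK => hn ⟨n, hnK, rfl⟩
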